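/- Conventions. For a Hermitian complex $d\times d$ matrix $A=U\operatorname{diag}(s_1,\dots,s_d)U^*$ put $\Phi(A)=U\operatorname{diag}(\Phi(s_1),\dots,\Phi(s_d))U^*$, and let $\overline{\operatorname{tr}}=\operatorname{tr}/d$ be the normalized trace. Let $\mathscr F_M$ be the set of all continuous convex functions $\Phi:[0,\infty)\to\mathbb R$ that are twice continuously differentiable on $(0,\infty)$, are not affine, and are such that for every $d\ge 1$ and every $t\in[0,1]$ the map $$(A,B)\mapsto \overline{\operatorname{tr}}\bigl(t\Phi(A)+(1-t)\Phi(B)-\Phi(tA+(1-t)B)\bigr)$$ is jointly convex on pairs of positive semidefinite $d\times d$ matrices. For a random variable $X$ with finitely many values and a function $F$ of $X$ with positive semidefinite $d\times d$ matrix values, the matrix $\Phi$-entropy is $$H_\Phi(F)=\overline{\operatorname{tr}}\bigl(\mathbb E[\Phi(F)]-\Phi(\mathbb E[F])\bigr).$$ For a pair $(X,Y)$ of such random variables, $\eta_\Phi^M(X;Y)$ is the infimum of all real constants $c$ such that $c\,H_\Phi(F)\ge H_\Phi(\mathbb E[F\mid Y])$ for all $d\ge1$ and all functions $F=F(X)$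 with positive semidefinite $d\times d$ matrix values. Proposition. Let $(X,Y)$ be a doubly symmetric binary source with parameter $\lambda$, that is, $X,Y$ take values in $\{0,1\}$ and $$\bigl(P(X=x,Y=y)\bigr)_{x,y\in\{0,1\}}=\begin{pmatrix}\frac{1+\lambda}4&\frac{1-\lambda}4\\[2pt] \frac{1-\lambda}4&\frac{1+\lambda}4\end{pmatrix}.$$ Then for every $\Phi\in\mathscr F_M$, $$\eta_\Phi^M(X;Y)=\lambda^2.$$ -/

import Mathlib

open MeasureTheory
open scoped ComplexOrder

noncomputable section

namespace MatrixPhi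

/-- The cone of positive semidefinite (Hermitian, complex) `d × d` matrices. -/
def psdCone (d : ℕ) : Set (Matrix (Fin d) (Fin d) ℂ) :=
  {A | A.PosSemidef}

/-- `Φ(A) = U diag(Φ(s₁), …, Φ(s_d)) U*` for a Hermitian matrix `A = U diag(s₁, …, s_d) U*`. -/
def matFun {d : ℕ} (Φ : ℝ → ℝ) (A : Matrix (Fin d) (Fin d) ℂ) : Matrix (Fin d) (Fin d) ℂ :=
  cfc Φ A

/-- The normalized trace `tr A / d`; it is only applied to Hermitian matrices, whose trace is
real. -/
def ntr {d : ℕ} (A : Matrix (Fin d) (Fin d) ℂ) : ℝ :=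
  A.trace.re / d

/-- The class of functions `Φ : [0, ∞) → ℝ` (values at negative arguments are irrelevant) that are
continuous, convex, `C²` on `(0, ∞)`, not affine, and whose matrix Jensen gap
`(A, B) ↦ tr (t Φ(A) + (1 - t) Φ(B) - Φ(t A + (1 - t) B))` is jointly convex on pairs of positive
semidefinite matrices, for every `t ∈ [0, 1]` and every dimension. -/
structure ClassFM (Φ : ℝ → ℝ) : Prop where
  continuousOn : ContinuousOn Φ (Set.Ici 0)
  convexOn : ConvexOn ℝ (Set.Ici 0) Φ
  contDiffOn : ContDiffOn ℝ 2 Φ (Set.Ioi 0)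
  not_affine : ¬ ∃ a b : ℝ, ∀ t : ℝ, 0 ≤ t → Φ t = a * t + b
  jointly_convex : ∀ d : ℕ, 0 < d → ∀ t : ℝ, 0 ≤ t → t ≤ 1 →
    ConvexOn ℝ (psdCone d ×ˢ psdCone d)
      (fun P : Matrix (Fin d) (Fin d) ℂ × Matrix (Fin d) (Fin d) ℂ =>
        ntr (t • matFun Φ P.1 + (1 - t) • matFun Φ P.2 - matFun Φ (t • P.1 + (1 - t) • P.2)))

section RandomVariables

variable {Ω 𝒳 𝒴 : Type*} [MeasurableSpace Ω] [Fintype 𝒳] [Fintype 𝒴] {d : ℕ}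

/-- The probability mass function of a random variable. -/
def pmf (μ : Measure Ω) (X : Ω → 𝒳) (x : 𝒳) : ℝ :=
  μ.real {ω | X ω = x}

/-- The joint probability mass function of a pair of random variables. -/
def jointPmf (μ : Measure Ω) (X : Ω → 𝒳) (Y : Ω → 𝒴) (x : 𝒳) (y : 𝒴) : ℝ :=
  μ.real {ω | X ω = x ∧ Y ω = y}

/-- The expectation `E[F(X)]` of a matrix-valued function of a finitely valued random variable. -/
def expect (μ : Measure Ω) (X : Ω → 𝒳) (F : 𝒳 → Matrix (Fin d) (Fin d) ℂ) :
    Matrix (Fin d) (Fin d) ℂ :=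
  ∑ x, pmf μ X x • F x

/-- The conditional expectation `E[F(X) | Y = y]`, as a function of `y`. -/
def condExpect (μ : Measure Ω) (X : Ω → 𝒳) (Y : Ω → 𝒴)
    (F : 𝒳 → Matrix (Fin d) (Fin d) ℂ) (y : 𝒴) : Matrix (Fin d) (Fin d) ℂ :=
  ∑ x, (jointPmf μ X Y x y / pmf μ Y y) • F x

/-- The matrix `Φ`-entropy `H_Φ(F) = tr (E[Φ(F(X))] - Φ(E[F(X)])) / d`. -/
def entropy (Φ : ℝ → ℝ) (μ : Measure Ω) (X : Ω → 𝒳) (F : 𝒳 → Matrix (Fin d) (Fin d) ℂ) : ℝ :=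
  ntr (expect μ X (fun x => matFun Φ (F x)) - matFun Φ (expect μ X F))

/-- The real constants `c` with `c H_Φ(F) ≥ H_Φ(E[F | Y])` for all positive semidefinite matrix
functions `F = F(X)` of every dimension. -/
def sdpiConstants (Φ : ℝ → ℝ) (μ : Measure Ω) (X : Ω → 𝒳) (Y : Ω → 𝒴) : Set ℝ :=
  {c | ∀ d : ℕ, 0 < d → ∀ F : 𝒳 → Matrix (Fin d) (Fin d) ℂ, (∀ x, (F x).PosSemidef) →
    entropy Φ μ Y (condExpect μ X Y F) ≤ c * entropy Φ μ X F}

/-- The matrix SDPI constant, the infimum of all admissible constants. It is taken in the extended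
reals, so that it is a true infimum (`⊤` if there is no admissible constant, `⊥` if they are
unbounded below). -/
def eta (Φ : ℝ → ℝ) (μ : Measure Ω) (X : Ω → 𝒳) (Y : Ω → 𝒴) : EReal :=
  sInf ((fun c : ℝ => (c : EReal)) '' sdpiConstants Φ μ X Y)

end RandomVariables

/-- `(X, Y)` is a doubly symmetric binary source with parameter `l`. -/
def IsDSBS {Ω : Type*} [MeasurableSpace Ω] (l : ℝ) (μ : Measure Ω) (X Y : Ω → Fin 2) : Prop :=
  Matrix.of (jointPmf μ X Y) = !![(1 + l) / 4, (1 - l) / 4; (1 - l) / 4, (1 + l) / 4]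

end MatrixPhi

end

/-!
Both `X` and `Y` are uniform on two points. Writing `F = (M + D, M - D)`, the conditional
expectation is `E[F | Y] = (M + l D, M - l D)`, so with `ψ(s) = ntr Φ(M + s D)` the inequality
`H(E[F | Y]) ≤ l² H(F)` reads
`ψ(l) + ψ(-l) - 2ψ(0) ≤ l² (ψ(1) + ψ(-1) - 2ψ(0))`.

Joint convexity of the Jensen gap (only the weight `t = 1/2` is needed), restricted to the line
`s ↦ (M + (s + ε) D, M + (s - ε) D)`, says that every second difference
`ψ(s + ε) + ψ(s - ε) - 2ψ(s)` is convex in `s`. Were `ψ` twice differentiable, `ψ''` would be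
convex, the even function `ψ''(s) + ψ''(-s)` would increase on `[0, 1]`, and integrating twice would
show that `(ψ(s) + ψ(-s) - 2ψ(0)) / s²` increases on `(0, 1]`. To avoid differentiating the
functional calculus, the integration is replaced by a summation along the grid `{0, ε, 2ε, …}`,
which gives the inequality for rational `l` (`sq_mul_le_sq_mul_of_secondDiff_mono`); continuity of
`ψ` gives the rest (`symm_secondDiff_le_sq_mul`).

For optimality it suffices to take `d = 1` and `F = (s + ε, s - ε)` at a point `s > 0` where
`Φ''(s) ≠ 0`, which exists because `Φ` is not affine: as `ε → 0` the ratio of the two entropies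
tends to `l²`.
-/

namespace MatrixPhi

open Filter Topology Set

/-! ### Functions with convex second differences -/

lemma ConvexOn.le_of_even {g : ℝ → ℝ} {r : ℝ} (hg : ConvexOn ℝ (Icc (-r) r) g)
    (heven : ∀ x, g (-x) = g x) {s t : ℝ} (hs : 0 ≤ s) (hst : s ≤ t) (ht : t ≤ r) :
    g s ≤ g t := by
  have hmem : s ∈ segment ℝ (-t) t := by
    rw [segment_eq_Icc (by linarith)]
    exact ⟨by linarith, hst⟩
  simpa [heven] using hg.le_on_segment ⟨by linarith, by linarith⟩ ⟨by linarith, ht⟩ hmem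

section Grid

variable {f : ℝ → ℝ}

/-- Discrete version of the fact that `s f'(s) ≥ 2 f(s)` for an even `f` with `f(0) = 0` whose
second derivative increases on `[0, 1]`. The first conjunct, the analogue of `s f''(s) ≥ f'(s)`,
carries the induction. -/
lemma secondDiff_ge_and_diff_ge (h0 : f 0 = 0) (heven : ∀ x, f (-x) = f x)
    (hmono : ∀ ε s t, 0 ≤ ε → 0 ≤ s → s ≤ t → t + ε ≤ 1 →
      f (s + ε) + f (s - ε) - 2 * f s ≤ f (t + ε) + f (t - ε) - 2 * f t)
    {ε : ℝ} (hε : 0 ≤ ε) (k : ℕ) (hk : (k + 1) * ε ≤ 1) :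
    2 * (f ((k + 1) * ε) - f (k * ε)) ≤
        (2 * k + 1) * (f ((k + 1) * ε) + f ((k - 1) * ε) - 2 * f (k * ε)) ∧
      (2 * k + 1) * f (k * ε) ≤ k ^ 2 * (f ((k + 1) * ε) - f (k * ε)) := by
  induction k with
  | zero => simp [h0, heven]; linarith
  | succ k ih =>
    push_cast at hk ⊢
    have hk' : ((k : ℝ) + 1) * ε ≤ 1 := by nlinarith
    obtain ⟨ih₁, ih₂⟩ := ih hk'
    have hm := hmono ε (k * ε) ((k + 1) * ε) hε (by positivity) (by nlinarith) (by linarith)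
    have e₁ : (k : ℝ) * ε + ε = (k + 1) * ε := by ring
    have e₂ : (k : ℝ) * ε - ε = (k - 1) * ε := by ring
    have e₃ : ((k : ℝ) + 1) * ε + ε = (k + 1 + 1) * ε := by ring
    have e₄ : ((k : ℝ) + 1) * ε - ε = k * ε := by ring
    rw [e₁, e₂, e₃, e₄] at hm
    have e₅ : ((k : ℝ) + 1 - 1) * ε = k * ε := by ring
    rw [e₅]
    generalize f (((k : ℝ) + 1 + 1) * ε) = b₂ at *
    generalize f (((k : ℝ) + 1) * ε) = b₁ at *
    generalize f ((k : ℝ) * ε) = b₀ at *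
    generalize f (((k : ℝ) - 1) * ε) = b at *
    have hk0 : (0 : ℝ) ≤ k := Nat.cast_nonneg k
    generalize (k : ℝ) = x at *
    have key : 2 * (b₁ - b₀) ≤ (2 * x + 1) * (b₂ + b₀ - 2 * b₁) :=
      ih₁.trans (mul_le_mul_of_nonneg_left hm (by positivity))
    refine ⟨by linarith, ?_⟩
    -- multiplied by `2k + 1`, the claim is `(k + 1)²` times `key` plus `2k + 3` times `ih₂`
    have hpos : 0 < 2 * x + 1 := by positivity
    refine le_of_mul_le_mul_left ?_ hpos
    have h₁ := mul_le_mul_of_nonneg_left key (sq_nonneg (x + 1))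
    have h₂ := mul_le_mul_of_nonneg_left ih₂ (by positivity : 0 ≤ 2 * x + 3)
    nlinarith

/-- Along a grid in `[0, 1]`, an even `f` with `f(0) = 0` and increasing second differences has
`f(s) / s²` increasing. -/
lemma sq_mul_le_sq_mul_of_secondDiff_mono (h0 : f 0 = 0) (heven : ∀ x, f (-x) = f x)
    (hmono : ∀ ε s t, 0 ≤ ε → 0 ≤ s → s ≤ t → t + ε ≤ 1 →
      f (s + ε) + f (s - ε) - 2 * f s ≤ f (t + ε) + f (t - ε) - 2 * f t)
    {ε : ℝ} (hε : 0 ≤ ε) {p q : ℕ} (hpq : p ≤ q) (hq : q * ε ≤ 1) :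
    (q : ℝ) ^ 2 * f (p * ε) ≤ p ^ 2 * f (q * ε) := by
  rcases Nat.eq_zero_or_pos p with rfl | hp
  · simp [h0]
  induction q, hpq using Nat.le_induction with
  | base => exact le_rfl
  | succ q hpq ih =>
    push_cast at hq ⊢
    have hq' : (q : ℝ) * ε ≤ 1 := by nlinarith
    have h₁ := ih hq'
    have h₂ := (secondDiff_ge_and_diff_ge h0 heven hmono hε q hq).2
    have h₃ : ((q : ℝ) + 1) ^ 2 * f (q * ε) ≤ q ^ 2 * f ((q + 1) * ε) := by linarith
    have hq0 : (0 : ℝ) < q := by exact_mod_cast hp.trans_le hpq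
    refine le_of_mul_le_mul_left ?_ (pow_pos hq0 2)
    have h₄ := mul_le_mul_of_nonneg_left h₁ (sq_nonneg ((q : ℝ) + 1))
    have h₅ := mul_le_mul_of_nonneg_left h₃ (sq_nonneg (p : ℝ))
    linarith

end Grid

/-- A continuous function on `[-1, 1]` all of whose second differences are convex has symmetric
second differences at `0` that grow at least quadratically. -/
lemma symm_secondDiff_le_sq_mul {ψ : ℝ → ℝ} (hcont : ContinuousOn ψ (Icc (-1) 1))
    (hconv : ∀ ε, 0 ≤ ε → ConvexOn ℝ (Icc (-(1 - ε)) (1 - ε))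
      (fun s => ψ (s + ε) + ψ (s - ε) - 2 * ψ s))
    {l : ℝ} (hl : |l| ≤ 1) :
    ψ l + ψ (-l) - 2 * ψ 0 ≤ l ^ 2 * (ψ 1 + ψ (-1) - 2 * ψ 0) := by
  set f : ℝ → ℝ := fun s => ψ s + ψ (-s) - 2 * ψ 0 with hf
  have h0 : f 0 = 0 := by simp [hf]; ring
  have heven : ∀ x, f (-x) = f x := fun x => by simp [hf]; ring
  have hmono : ∀ ε s t, 0 ≤ ε → 0 ≤ s → s ≤ t → t + ε ≤ 1 →
      f (s + ε) + f (s - ε) - 2 * f s ≤ f (t + ε) + f (t - ε) - 2 * f t := by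
    intro ε s t hε hs hst ht
    have hneg : ConvexOn ℝ (Icc (-(1 - ε)) (1 - ε))
        (fun s => ψ (-s + ε) + ψ (-s - ε) - 2 * ψ (-s)) := by
      have := (hconv ε hε).comp_linearMap (-LinearMap.id)
      rwa [show ⇑(-LinearMap.id : ℝ →ₗ[ℝ] ℝ) ⁻¹' Icc (-(1 - ε)) (1 - ε) = Icc (-(1 - ε)) (1 - ε) by
        ext x
        simp only [mem_Icc, mem_preimage, LinearMap.neg_apply, LinearMap.id_apply]
        constructor <;> rintro ⟨h₁, h₂⟩ <;> constructor <;> linarith] at this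
    refine ConvexOn.le_of_even (g := fun s => f (s + ε) + f (s - ε) - 2 * f s) (r := 1 - ε)
      ?_ ?_ hs hst (by linarith)
    · refine ((hconv ε hε).add hneg).congr fun x _ => ?_
      simp only [hf, Pi.add_apply]
      rw [show -(x + ε) = -x - ε by ring, show -(x - ε) = -x + ε by ring]
      ring
    · intro x
      rw [show -x + ε = -(x - ε) by ring, show -x - ε = -(x + ε) by ring, heven, heven, heven]
      ring
  have hfc : ContinuousOn f (Icc 0 1) := by
    have h₁ : ContinuousOn ψ (Icc 0 1) := hcont.mono (Icc_subset_Icc (by norm_num) le_rfl)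
    have h₂ : ContinuousOn (fun s => ψ (-s)) (Icc 0 1) :=
      hcont.comp continuous_neg.continuousOn
        (fun s hs => ⟨by linarith [hs.2], by linarith [hs.1]⟩)
    exact (h₁.add h₂).sub continuousOn_const
  -- `|l|` is the limit of the rationals `⌊|l| n⌋ / n`, to which the grid inequality applies
  have hlim := tendsto_nat_floor_mul_div_atTop (R := ℝ) (abs_nonneg l)
  have hlim' := hlim.comp tendsto_natCast_atTop_atTop
  have hgrid : ∀ᶠ n : ℕ in atTop, (⌊|l| * n⌋₊ : ℝ) / n ∈ Icc (0 : ℝ) 1 ∧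
      f ((⌊|l| * n⌋₊ : ℝ) / n) ≤ ((⌊|l| * n⌋₊ : ℝ) / n) ^ 2 * f 1 := by
    filter_upwards [eventually_gt_atTop 0] with n hn
    have hn' : (0 : ℝ) < n := by exact_mod_cast hn
    have hle : ⌊|l| * n⌋₊ ≤ n := by
      refine Nat.floor_le_of_le ?_
      nlinarith
    have hle' : (⌊|l| * n⌋₊ : ℝ) ≤ n := by exact_mod_cast hle
    refine ⟨⟨by positivity, div_le_one_of_le₀ hle' hn'.le⟩, ?_⟩
    have h := sq_mul_le_sq_mul_of_secondDiff_mono h0 heven hmono (ε := 1 / n) (by positivity) hle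
      (by field_simp; exact le_rfl)
    rw [mul_one_div_cancel hn'.ne', mul_one_div] at h
    rw [div_pow, div_mul_eq_mul_div, le_div_iff₀ (by positivity)]
    linarith
  have hin : Tendsto (fun n : ℕ => (⌊|l| * n⌋₊ : ℝ) / n) atTop (𝓝[Icc 0 1] |l|) :=
    tendsto_nhdsWithin_iff.2 ⟨hlim', hgrid.mono fun _ h => h.1⟩
  have hle : f |l| ≤ |l| ^ 2 * f 1 :=
    le_of_tendsto_of_tendsto ((hfc |l| ⟨abs_nonneg l, hl⟩).tendsto.comp hin)
      ((hlim'.pow 2).mul_const (f 1)) (hgrid.mono fun _ h => h.2)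
  have hfl : f |l| = f l := by
    rcases abs_choice l with h | h <;> rw [h]
    exact heven l
  rwa [hfl, sq_abs] at hle

/-! ### The trace functional along a segment of positive semidefinite matrices -/

section Trace

variable {d : ℕ}

lemma ntr_add (A B : Matrix (Fin d) (Fin d) ℂ) : ntr (A + B) = ntr A + ntr B := by
  simp [ntr, Matrix.trace_add, add_div]

lemma ntr_sub (A B : Matrix (Fin d) (Fin d) ℂ) : ntr (A - B) = ntr A - ntr B := by
  simp [ntr, Matrix.trace_sub, sub_div]

lemma ntr_smul (c : ℝ) (A : Matrix (Fin d) (Fin d) ℂ) : ntr (c • A) = c * ntr A := by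
  simp [ntr, Matrix.trace_smul, mul_div_assoc]

open scoped Matrix.Norms.L2Operator in
lemma continuousOn_ntr_matFun {Φ : ℝ → ℝ} (hΦ : ContinuousOn Φ (Ici 0)) {K : Set ℝ}
    (hK : IsCompact K) {A : ℝ → Matrix (Fin d) (Fin d) ℂ} (hA : ContinuousOn A K)
    (hpos : ∀ s ∈ K, (A s).PosSemidef) : ContinuousOn (fun s => ntr (matFun Φ (A s))) K := by
  -- on the compact set `K` the spectra of the `A s` stay in one compact interval of `[0, ∞)`
  obtain ⟨C, hC⟩ := hK.exists_bound_of_continuousOn hA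
  have hcfc : ContinuousOn (fun s => cfc Φ (A s)) K := by
    refine ContinuousOn.cfc' (s := Icc 0 (C * ‖(1 : Matrix (Fin d) (Fin d) ℂ)‖)) isCompact_Icc Φ
      hA (fun s hs x hx => ?_) (fun s hs => (hpos s hs).isHermitian)
      (hΦ.mono Icc_subset_Ici_self)
    refine ⟨?_, ?_⟩
    · rw [(hpos s hs).isHermitian.spectrum_real_eq_range_eigenvalues] at hx
      obtain ⟨i, rfl⟩ := hx
      exact (hpos s hs).eigenvalues_nonneg i
    · have h₁ := spectrum.norm_le_norm_mul_of_mem hx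
      exact (le_abs_self x).trans (h₁.trans (by gcongr; exact hC s hs))
  unfold ntr matFun
  exact (Complex.continuous_re.comp_continuousOn
    ((continuous_id.matrix_trace).comp_continuousOn hcfc)).div_const _

lemma posSemidef_add_smul_sub {M D : Matrix (Fin d) (Fin d) ℂ} (h₁ : (M + D).PosSemidef)
    (h₂ : (M - D).PosSemidef) {s : ℝ} (hs : s ∈ Icc (-1 : ℝ) 1) : (M + s • D).PosSemidef := by
  have h : M + s • D = ((1 + s) / 2) • (M + D) + ((1 - s) / 2) • (M - D) := by module
  rw [h]
  exact (h₁.smul (by linarith [hs.1])).add (h₂.smul (by linarith [hs.2]))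

end Trace

/-- The entropy contraction `H(E[F | Y]) ≤ l² H(F)` for `F = (M + D, M - D)`, in terms of traces. -/
lemma ClassFM.symm_secondDiff_le {Φ : ℝ → ℝ} (hΦ : ClassFM Φ) {d : ℕ} (hd : 0 < d)
    {M D : Matrix (Fin d) (Fin d) ℂ} (h₁ : (M + D).PosSemidef) (h₂ : (M - D).PosSemidef)
    {l : ℝ} (hl : |l| ≤ 1) :
    ntr (matFun Φ (M + l • D)) + ntr (matFun Φ (M - l • D)) - 2 * ntr (matFun Φ M) ≤
      l ^ 2 * (ntr (matFun Φ (M + D)) + ntr (matFun Φ (M - D)) - 2 * ntr (matFun Φ M)) := by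
  have hpos : ∀ s ∈ Icc (-1 : ℝ) 1, (M + s • D).PosSemidef := fun s hs =>
    posSemidef_add_smul_sub h₁ h₂ hs
  have key := symm_secondDiff_le_sq_mul (ψ := fun s => ntr (matFun Φ (M + s • D))) (l := l)
    (continuousOn_ntr_matFun hΦ.continuousOn isCompact_Icc (by fun_prop) hpos) ?_ hl
  · simpa [← sub_eq_add_neg] using key
  intro ε hε
  have hgap : ∀ s : ℝ, ntr ((1 / 2 : ℝ) • matFun Φ (M + (s + ε) • D) +
        (1 - 1 / 2 : ℝ) • matFun Φ (M + (s - ε) • D) - matFun Φ ((1 / 2 : ℝ) • (M + (s + ε) • D) +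
        (1 - 1 / 2 : ℝ) • (M + (s - ε) • D))) = (ntr (matFun Φ (M + (s + ε) • D)) +
        ntr (matFun Φ (M + (s - ε) • D)) - 2 * ntr (matFun Φ (M + s • D))) / 2 := by
    intro s
    rw [show (1 / 2 : ℝ) • (M + (s + ε) • D) + (1 - 1 / 2 : ℝ) • (M + (s - ε) • D) = M + s • D by
      module, ntr_sub, ntr_add, ntr_smul, ntr_smul]
    ring
  have hmem : ∀ s ∈ Icc (-(1 - ε)) (1 - ε),
      (M + (s + ε) • D, M + (s - ε) • D) ∈ psdCone d ×ˢ psdCone d := fun s hs =>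
    ⟨hpos _ ⟨by linarith [hs.1], by linarith [hs.2]⟩,
      hpos _ ⟨by linarith [hs.1], by linarith [hs.2]⟩⟩
  refine ⟨convex_Icc _ _, fun x hx y hy a b ha hb hab => ?_⟩
  have h := (hΦ.jointly_convex d hd (1 / 2) (by norm_num) (by norm_num)).2
    (hmem x hx) (hmem y hy) ha hb hab
  have hline : a • (M + (x + ε) • D, M + (x - ε) • D) + b • (M + (y + ε) • D, M + (y - ε) • D) =
      (M + (a • x + b • y + ε) • D, M + (a • x + b • y - ε) • D) := by
    obtain rfl : b = 1 - a := by linarith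
    simp only [Prod.smul_mk, Prod.mk_add_mk, smul_eq_mul]
    congr 1 <;> module
  rw [hline] at h
  simp only [hgap, smul_eq_mul] at h ⊢
  linarith

/-! ### Second-order expansion of scalar second differences -/

lemma tendsto_symm_secondDiff_div_sq {f : ℝ → ℝ} {U : Set ℝ} (hU : IsOpen U) (hc : Convex ℝ U)
    (hf : ContDiffOn ℝ 2 f U) {s : ℝ} (hs : s ∈ U) :
    Tendsto (fun h => (f (s + h) + f (s - h) - 2 * f s) / h ^ 2) (𝓝[>] 0)
      (𝓝 (iteratedDerivWithin 2 f U s)) := by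
  have hT := Real.taylor_tendsto (n := 2) hc hs hf
  rw [hU.nhdsWithin_eq hs] at hT
  have h₁ : Tendsto (fun h : ℝ => s + h) (𝓝[>] 0) (𝓝 s) :=
    ((continuous_const.add continuous_id).tendsto' 0 s (by simp)).mono_left nhdsWithin_le_nhds
  have h₂ : Tendsto (fun h : ℝ => s - h) (𝓝[>] 0) (𝓝 s) :=
    ((continuous_const.sub continuous_id).tendsto' 0 s (by simp)).mono_left nhdsWithin_le_nhds
  have h := ((hT.comp h₁).add (hT.comp h₂)).add_const (iteratedDerivWithin 2 f U s)
  rw [add_zero, zero_add] at h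
  refine h.congr' ?_
  filter_upwards [self_mem_nhdsWithin] with x hx
  have hx' : x ≠ 0 := ne_of_gt hx
  simp [taylor_within_apply]
  field_simp
  ring

lemma ClassFM.exists_iteratedDerivWithin_ne_zero {Φ : ℝ → ℝ} (hΦ : ClassFM Φ) :
    ∃ s ∈ Ioi (0 : ℝ), iteratedDerivWithin 2 Φ (Ioi 0) s ≠ 0 := by
  by_contra! hzero
  have hopen : IsOpen (Ioi (0 : ℝ)) := isOpen_Ioi
  have hpre : IsPreconnected (Ioi (0 : ℝ)) := isPreconnected_Ioi
  have hd₁ : DifferentiableOn ℝ Φ (Ioi 0) := hΦ.contDiffOn.differentiableOn (by norm_num)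
  have hd₂ : DifferentiableOn ℝ (deriv Φ) (Ioi 0) :=
    (hΦ.contDiffOn.deriv_of_isOpen (m := 1) hopen (by norm_num)).differentiableOn (by norm_num)
  obtain ⟨a, ha⟩ := hopen.exists_is_const_of_deriv_eq_zero hpre hd₂ (fun x hx => by
    have h := hzero x hx
    rw [iteratedDerivWithin_of_isOpen hopen hx, iteratedDeriv_succ, iteratedDeriv_one] at h
    exact h)
  obtain ⟨b, hb⟩ := hopen.exists_is_const_of_deriv_eq_zero (f := fun x => Φ x - a * x) hpre
    (hd₁.sub (by fun_prop)) (fun x hx => by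
      have h : HasDerivAt Φ (deriv Φ x) x :=
        ((hd₁ x hx).differentiableAt (hopen.mem_nhds hx)).hasDerivAt
      have h' : HasDerivAt (fun x => Φ x - a * x) (deriv Φ x - a * 1) x :=
        h.sub ((hasDerivAt_id x).const_mul a)
      rw [h'.deriv, ha x hx]
      simp)
  refine hΦ.not_affine ⟨a, b, fun t ht => ?_⟩
  -- the identity on `(0, ∞)` extends to `0` by continuity
  have hcl : EqOn (fun x => Φ x) (fun x => a * x + b) (Ici 0) := by
    refine EqOn.of_subset_closure (s := Ioi 0) (fun x hx => ?_) hΦ.continuousOn (by fun_prop)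
      Ioi_subset_Ici_self (by rw [closure_Ioi])
    exact sub_eq_iff_eq_add'.1 (hb x hx)
  exact hcl ht

/-! ### The doubly symmetric binary source -/

section Source

variable {Ω : Type*} [MeasurableSpace Ω] {μ : Measure Ω} {X Y : Ω → Fin 2} {l : ℝ} {d : ℕ}

lemma pmf_eq_sum_jointPmf [IsFiniteMeasure μ] (hY : Measurable Y) (x : Fin 2) :
    pmf μ X x = ∑ y, jointPmf μ X Y x y := by
  have h := measureReal_inter_add_sdiff (μ := μ) (s := {ω | X ω = x})
    (hY (measurableSet_singleton (0 : Fin 2)))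
  have h₁ : {ω | X ω = x} \ Y ⁻¹' {0} = {ω | X ω = x ∧ Y ω = 1} := by
    ext ω
    simp only [Set.mem_sdiff, mem_ofPred_eq, mem_preimage, mem_singleton_iff]
    exact and_congr_right fun _ => by omega
  rw [h₁] at h
  rw [Fin.sum_univ_two]
  exact h.symm

lemma jointPmf_swap (x y : Fin 2) : jointPmf μ Y X y x = jointPmf μ X Y x y := by
  simp only [jointPmf, and_comm]

lemma IsDSBS.jointPmf_eq (h : IsDSBS l μ X Y) (x y : Fin 2) :
    jointPmf μ X Y x y = if x = y then (1 + l) / 4 else (1 - l) / 4 := by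
  have h' := congrFun (congrFun h x) y
  rw [Matrix.of_apply] at h'
  rw [h']
  fin_cases x <;> fin_cases y <;> simp

lemma IsDSBS.abs_le_one (h : IsDSBS l μ X Y) : |l| ≤ 1 := by
  have h₁ := h.jointPmf_eq 0 0
  have h₂ := h.jointPmf_eq 0 1
  have h₃ : 0 ≤ jointPmf μ X Y 0 0 := measureReal_nonneg
  have h₄ : 0 ≤ jointPmf μ X Y 0 1 := measureReal_nonneg
  simp only [if_true, zero_ne_one, if_false] at h₁ h₂
  exact _root_.abs_le.2 ⟨by linarith, by linarith⟩

lemma IsDSBS.pmf_left [IsFiniteMeasure μ] (h : IsDSBS l μ X Y) (hY : Measurable Y) (x : Fin 2) :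
    pmf μ X x = 1 / 2 := by
  rw [pmf_eq_sum_jointPmf hY, Fin.sum_univ_two, h.jointPmf_eq, h.jointPmf_eq]
  fin_cases x <;> simp <;> ring

lemma IsDSBS.pmf_right [IsFiniteMeasure μ] (h : IsDSBS l μ X Y) (hX : Measurable X) (y : Fin 2) :
    pmf μ Y y = 1 / 2 := by
  rw [pmf_eq_sum_jointPmf hX, Fin.sum_univ_two, jointPmf_swap (X := X), jointPmf_swap (X := X),
    h.jointPmf_eq, h.jointPmf_eq]
  fin_cases y <;> simp <;> ring

lemma IsDSBS.condExpect_eq [IsFiniteMeasure μ] (h : IsDSBS l μ X Y) (hX : Measurable X)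
    (M D : Matrix (Fin d) (Fin d) ℂ) :
    condExpect μ X Y ![M + D, M - D] = ![M + l • D, M - l • D] := by
  funext y
  simp only [condExpect, Fin.sum_univ_two, h.jointPmf_eq, h.pmf_right hX]
  fin_cases y <;> simp <;> module

lemma entropy_of_uniform {Φ : ℝ → ℝ} (h : ∀ x, pmf μ X x = 1 / 2)
    (M D : Matrix (Fin d) (Fin d) ℂ) :
    entropy Φ μ X ![M + D, M - D] =
      (ntr (matFun Φ (M + D)) + ntr (matFun Φ (M - D)) - 2 * ntr (matFun Φ M)) / 2 := by
  have hM : (1 / 2 : ℝ) • (M + D) + (1 / 2 : ℝ) • (M - D) = M := by module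
  simp only [entropy, expect, Fin.sum_univ_two, h, Matrix.cons_val_zero, Matrix.cons_val_one, hM,
    ntr_sub, ntr_add, ntr_smul]
  ring

lemma ntr_matFun_algebraMap (Φ : ℝ → ℝ) (s : ℝ) :
    ntr (matFun Φ (algebraMap ℝ (Matrix (Fin 1) (Fin 1) ℂ) s)) = Φ s := by
  rw [matFun, cfc_algebraMap]
  simp [ntr, Matrix.trace, Matrix.algebraMap_matrix_apply]

lemma IsDSBS.sq_mem_sdpiConstants [IsFiniteMeasure μ] (h : IsDSBS l μ X Y) (hX : Measurable X)
    (hY : Measurable Y) {Φ : ℝ → ℝ} (hΦ : ClassFM Φ) : l ^ 2 ∈ sdpiConstants Φ μ X Y := by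
  intro d hd F hF
  obtain ⟨M, D, rfl⟩ : ∃ M D, F = ![M + D, M - D] :=
    ⟨(1 / 2 : ℝ) • (F 0 + F 1), (1 / 2 : ℝ) • (F 0 - F 1), by
      funext x; fin_cases x <;> simp <;> module⟩
  rw [h.condExpect_eq hX, entropy_of_uniform (h.pmf_right hX), entropy_of_uniform (h.pmf_left hY)]
  linarith [hΦ.symm_secondDiff_le hd (hF 0) (hF 1) h.abs_le_one]

/-- The contraction inequality with constant `c`, tested on the `1 × 1` matrices
`F = (s + ε, s - ε)`. -/
lemma IsDSBS.scalar_le_of_mem_sdpiConstants [IsFiniteMeasure μ] (h : IsDSBS l μ X Y)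
    (hX : Measurable X) (hY : Measurable Y) {Φ : ℝ → ℝ} {c : ℝ} (hc : c ∈ sdpiConstants Φ μ X Y)
    {s ε : ℝ} (hε : 0 ≤ ε) (hs : ε ≤ s) :
    Φ (s + l * ε) + Φ (s - l * ε) - 2 * Φ s ≤ c * (Φ (s + ε) + Φ (s - ε) - 2 * Φ s) := by
  have hpos : ∀ r : ℝ, 0 ≤ r → (algebraMap ℝ (Matrix (Fin 1) (Fin 1) ℂ) r).PosSemidef :=
    fun r hr => by
      rw [Algebra.algebraMap_eq_smul_one]
      exact Matrix.PosSemidef.one.smul hr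
  have key := hc 1 one_pos
    ![algebraMap ℝ _ s + algebraMap ℝ _ ε, algebraMap ℝ _ s - algebraMap ℝ _ ε]
    (fun x => by
      fin_cases x
      · simpa using hpos (s + ε) (by linarith)
      · simpa using hpos (s - ε) (by linarith))
  rw [h.condExpect_eq hX, entropy_of_uniform (h.pmf_right hX), entropy_of_uniform (h.pmf_left hY),
    Algebra.smul_def, ← map_mul] at key
  simp only [← map_add, ← map_sub, ntr_matFun_algebraMap] at key
  linarith

lemma IsDSBS.sq_le_of_mem_sdpiConstants [IsFiniteMeasure μ] (h : IsDSBS l μ X Y)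
    (hX : Measurable X) (hY : Measurable Y) {Φ : ℝ → ℝ} (hΦ : ClassFM Φ) {c : ℝ}
    (hc : c ∈ sdpiConstants Φ μ X Y) : l ^ 2 ≤ c := by
  obtain ⟨s, hs, hL⟩ := hΦ.exists_iteratedDerivWithin_ne_zero
  set L := iteratedDerivWithin 2 Φ (Ioi 0) s
  have hs' : 0 < s := hs
  have hlim : Tendsto (fun h => (Φ (s + h) + Φ (s - h) - 2 * Φ s) / h ^ 2) (𝓝[>] 0) (𝓝 L) :=
    tendsto_symm_secondDiff_div_sq isOpen_Ioi (convex_Ioi 0) hΦ.contDiffOn hs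
  have hsmall : ∀ᶠ ε in 𝓝[>] (0 : ℝ), 0 < ε ∧ ε ≤ s := by
    filter_upwards [Ioc_mem_nhdsGT hs'] with ε hε using hε
  -- `L ≥ 0` by convexity of `Φ`
  have hLpos : 0 < L := by
    refine lt_of_le_of_ne (ge_of_tendsto hlim ?_) hL.symm
    filter_upwards [hsmall] with ε hε
    have hcv := hΦ.convexOn.2 (mem_Ici.2 (by linarith) : s + ε ∈ Ici 0)
      (mem_Ici.2 (by linarith) : s - ε ∈ Ici 0) (by norm_num : (0 : ℝ) ≤ 1 / 2)
      (by norm_num : (0 : ℝ) ≤ 1 / 2) (by norm_num)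
    simp only [smul_eq_mul] at hcv
    rw [show 1 / 2 * (s + ε) + 1 / 2 * (s - ε) = s by ring] at hcv
    exact div_nonneg (by linarith) (sq_nonneg ε)
  have hlim_l : Tendsto (fun ε => (Φ (s + l * ε) + Φ (s - l * ε) - 2 * Φ s) / ε ^ 2) (𝓝[>] 0)
      (𝓝 (l ^ 2 * L)) := by
    have hscale : ∀ k : ℝ, 0 < k →
        Tendsto (fun ε => (Φ (s + k * ε) + Φ (s - k * ε) - 2 * Φ s) / ε ^ 2) (𝓝[>] 0)
          (𝓝 (k ^ 2 * L)) := by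
      intro k hk
      have hmul : Tendsto (fun ε : ℝ => k * ε) (𝓝[>] 0) (𝓝[>] 0) :=
        tendsto_nhdsWithin_iff.2
          ⟨((continuous_const.mul continuous_id).tendsto' 0 0 (by simp)).mono_left
            nhdsWithin_le_nhds, by
            filter_upwards [self_mem_nhdsWithin] with ε hε using mul_pos hk hε⟩
      refine ((hlim.comp hmul).const_mul (k ^ 2)).congr fun ε => ?_
      rw [Function.comp_apply, mul_pow, ← mul_div_assoc,
        mul_div_mul_left _ _ (pow_pos hk 2).ne']
    -- the second difference is even in `l`, and vanishes for `l = 0`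
    rcases lt_trichotomy l 0 with hl | rfl | hl
    · have := hscale (-l) (by linarith)
      rw [neg_sq] at this
      refine this.congr fun ε => ?_
      rw [neg_mul, ← sub_eq_add_neg, sub_neg_eq_add, add_comm (Φ _)]
    · refine tendsto_const_nhds.congr fun ε => ?_
      simp only [zero_mul, add_zero, sub_zero]
      ring
    · exact hscale l hl
  refine le_of_mul_le_mul_right ?_ hLpos
  refine le_of_tendsto_of_tendsto hlim_l (hlim.const_mul c) ?_
  filter_upwards [hsmall] with ε hε
  rw [← mul_div_assoc]
  exact div_le_div_of_nonneg_right (h.scalar_le_of_mem_sdpiConstants hX hY hc hε.1.le hε.2)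
    (sq_nonneg ε)

end Source

end MatrixPhi

theorem mainTheorem10 {Ω : Type*} [MeasurableSpace Ω] (μ : Measure Ω) [IsProbabilityMeasure μ]
    (X Y : Ω → Fin 2) (hX : Measurable X) (hY : Measurable Y) (l : ℝ)
    (hXY : MatrixPhi.IsDSBS l μ X Y) (Φ : ℝ → ℝ) (hΦ : MatrixPhi.ClassFM Φ) :
    MatrixPhi.eta Φ μ X Y = ((l ^ 2 : ℝ) : EReal) := by
  refine le_antisymm (sInf_le ⟨l ^ 2, hXY.sq_mem_sdpiConstants hX hY hΦ, rfl⟩) (le_sInf ?_)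
  rintro _ ⟨c, hc, rfl⟩
  exact EReal.coe_le_coe_iff.2 (hXY.sq_le_of_mem_sdpiConstants hX hY hΦ hc)
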